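/- For a probability mass function $P=\{p(i)\}_{i\ge 0}$ on $\{0,1,2,\dots\}$ and a binary prefix code $c:\{0,1,2,\dots\}\to\{0,1\}^*$ with codeword lengths $N=\{n(i)\}$, the maximal pointwise redundancy is $R^*(N,P)=\sup_{i}\,[\,n(i)+\log_2 p(i)\,]$. For $\theta\in(0,1)$ let $P_\theta$ be the geometric distribution $p_\theta(i)=(1-\theta)\theta^i$, and let $R^*(\theta)$ denote the infimum of $R^*(N,P_\theta)$ over all binary prefix codes. Write $\langle x\rangle=x-\lfloor x\rfloor$. (1) For every $\theta\in[1/2,1)$ the infimum is attained by some code; for each code with lengths $N^{**}_\theta$ attaining it the supremum is a maximum; and, with $k=\lceil -1/\log_2\theta\rceil$, $$\begin{aligned}R^*(\theta)=\max_i\,[\,n^{**}_\theta(i)+\log_2p_\theta(i)\,]&=1+\lceil\log_2 k\rceil+\log_2(1-\theta)+\bigl(2^{\lceil\log_2 k\rceil}-k\bigr)\log_2\theta\\&=2+\log_2\Bigl(-\frac{1-\theta}{\log_2\theta}\Bigr)-k\log_2\theta-2^{\,1-\langle\log_2(-1/\log_2\theta)\rangle}-\Bigl\langle\log_2\Bigl(-\frac1{\log_2\theta}\Bigr)\Bigr\rangle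 .\end{aligned}$$ (2) As $\theta\uparrow1$, $$R^*(\theta)=3-\log_2\log_2 e-2^{\,1-\langle\log_2(-1/\log_2\theta)\rangle}-\Bigl\langle\log_2\Bigl(-\frac1{\log_2\theta}\Bigr)\Bigr\rangle+O(1-\theta).$$ (3) $\displaystyle\liminf_{\theta\uparrow1}R^*(\theta)=1-\log_2\log_2 e$ and $\displaystyle\limsup_{\theta\uparrow1}R^*(\theta)=2-\log_2 e$. -/

import Mathlib

open Filter Topology Asymptotics

/-- A binary prefix code for the alphabet `{0, 1, 2, …}`: no codeword is a prefix of the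
codeword of a different symbol (in particular, distinct symbols have distinct codewords). -/
def IsPrefixCode (c : ℕ → List Bool) : Prop :=
  ∀ i j : ℕ, i ≠ j → ¬ (c i <+: c j)

/-- The geometric distribution `p_θ(i) = (1 - θ) θ ^ i`. -/
noncomputable def geometricProb (θ : ℝ) (i : ℕ) : ℝ := (1 - θ) * θ ^ i

/-- The pointwise redundancy `n(i) + log₂ p(i)`, where `n(i)` is the length of codeword `i`. -/
noncomputable def pointwiseRedundancy (c : ℕ → List Bool) (p : ℕ → ℝ) (i : ℕ) : ℝ :=
  ((c i).length : ℝ) + Real.logb 2 (p i)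

/-- The maximal pointwise redundancy `R*(N, P) = sup_i [n(i) + log₂ p(i)]`; it is an extended
real number since the pointwise redundancy may be unbounded. -/
noncomputable def maximalRedundancy (c : ℕ → List Bool) (p : ℕ → ℝ) : EReal :=
  ⨆ i : ℕ, ((pointwiseRedundancy c p i : ℝ) : EReal)

/-- `c` is a prefix code that minimizes maximal pointwise redundancy among all prefix codes. -/
def MinimizesMaximalRedundancy (c : ℕ → List Bool) (p : ℕ → ℝ) : Prop :=
  IsPrefixCode c ∧
    ∀ c' : ℕ → List Bool, IsPrefixCode c' → maximalRedundancy c p ≤ maximalRedundancy c' p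

/-- The minimal maximal pointwise redundancy over all prefix codes. -/
noncomputable def minimalMaximalRedundancy (p : ℕ → ℝ) : EReal :=
  ⨅ c : {c : ℕ → List Bool // IsPrefixCode c}, maximalRedundancy c.1 p

/-!
Write `a = -log₂ θ`, `k = ⌈1 / a⌉`, `L = ⌈log₂ k⌉` and `d = 2 ^ L - k`; the first closed form is
then `1 + L + log₂ (1 - θ) - d a`. The Golomb code with parameter `k` reaches it
(`length_golombCode_le`): moving from `i` to `i + k` costs one digit and gains `k a ≥ 1`, and among
the first `k` symbols the worst one is `d`, the first with a long codeword for its remainder.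

No prefix code does better (`IsPrefixCode.exists_length_ge`). If every pointwise redundancy were
smaller, the symbols up to `d` would have length at most `L` and the symbols with `(i - d) a ≤ j`
length at most `L + j`. Since `(k - 1) a < 1`, each level contains at least `k - 1` new symbols, and
`d + 1 + (k - 1) = 2 ^ L`, so Kraft's inequality would have to hold with equality; but `1 / a`
strictly exceeds `k - 1`, which produces additional symbols and a contradiction. Because this gives
one bad symbol for each code, the supremum of every optimal code is a maximum.

The second closed form follows from `⌈log₂ ⌈x⌉⌉ = ⌈log₂ x⌉` for `x ≥ 1`. It differs from the
expansion by at most `a`, which is `O(1 - θ)` (`abs_geometricRedundancy_sub_le`). The limits inferior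
and superior then come from the maximum `2` and the minimum `1 + log₂ e - log₂ log₂ e` of
`2 ^ (1 - t) + t` on `[0, 1)`, each being taken along a sequence of sources `θ ↑ 1` for which
`⟨log₂ (-1 / log₂ θ)⟩ = t` is constant.
-/

/-! ### Kraft's inequality for prefix codes -/

lemma IsPrefixCode.injective {c : ℕ → List Bool} (hc : IsPrefixCode c) :
    Function.Injective c := by
  intro i j hij
  by_contra hne
  exact hc i j hne (hij ▸ List.prefix_rfl)

lemma IsPrefixCode.ne_nil {c : ℕ → List Bool} (hc : IsPrefixCode c) (i : ℕ) : c i ≠ [] := by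
  intro h
  exact hc i (i + 1) (by omega) (h ▸ List.nil_prefix)

lemma IsPrefixCode.uniquelyDecodable {c : ℕ → List Bool} (hc : IsPrefixCode c) :
    InformationTheory.UniquelyDecodable (Set.range c) := by
  intro L₁
  induction L₁ with
  | nil =>
    intro L₂ _ h₂ h
    cases L₂ with
    | nil => rfl
    | cons w L₂ =>
      obtain ⟨i, rfl⟩ := h₂ w (by simp)
      simp [hc.ne_nil] at h
  | cons v L₁ ih =>
    intro L₂ h₁ h₂ h
    obtain ⟨i, rfl⟩ := h₁ v (by simp)
    cases L₂ with
    | nil => simp [hc.ne_nil] at h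
    | cons w L₂ =>
      obtain ⟨j, rfl⟩ := h₂ w (by simp)
      rw [List.flatten_cons, List.flatten_cons] at h
      have hij : i = j := by
        by_contra hne
        rcases List.prefix_or_prefix_of_prefix (List.prefix_append (c i) L₁.flatten)
          (h ▸ List.prefix_append (c j) L₂.flatten) with hp | hp
        · exact hc i j hne hp
        · exact hc j i (Ne.symm hne) hp
      subst hij
      rw [List.append_cancel_left_eq] at h
      rw [ih L₂ (fun w hw => h₁ w (by simp [hw])) (fun w hw => h₂ w (by simp [hw])) h]

lemma IsPrefixCode.sum_le_one {c : ℕ → List Bool} (hc : IsPrefixCode c) (s : Finset ℕ) :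
    ∑ i ∈ s, (1 / 2 : ℝ) ^ (c i).length ≤ 1 := by
  classical
  have hud : InformationTheory.UniquelyDecodable
      ((s.image c : Finset (List Bool)) : Set (List Bool)) := by
    intro L₁ L₂ h₁ h₂
    refine hc.uniquelyDecodable L₁ L₂ (fun w hw => ?_) (fun w hw => ?_)
    · obtain ⟨i, -, hi⟩ := Finset.mem_image.1 (Finset.mem_coe.1 (h₁ w hw))
      exact ⟨i, hi⟩
    · obtain ⟨i, -, hi⟩ := Finset.mem_image.1 (Finset.mem_coe.1 (h₂ w hw))
      exact ⟨i, hi⟩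
  have h := InformationTheory.kraft_mcmillan_inequality hud
  rw [Finset.sum_image fun i _ j _ hij => hc.injective hij] at h
  simpa using h

/-! ### The lower bound for every prefix code -/

/-- A block of `s` symbols for each level `1, …, J`, those of level `j` having length at most
`L + j`, fills at least `s (1 - 2⁻ᴶ)` of the Kraft mass `2⁻ᴸ`. -/
lemma sum_blocks_ge {n : ℕ → ℕ} {L s : ℕ}
    (hn : ∀ j m, m < (j + 1) * s → n m ≤ L + (j + 1)) (J : ℕ) :
    (1 / 2 : ℝ) ^ L * (s * (1 - (1 / 2) ^ J)) ≤
      ∑ m ∈ Finset.range (J * s), (1 / 2 : ℝ) ^ n m := by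
  induction J with
  | zero => simp
  | succ J ih =>
    rw [add_mul, one_mul, Finset.sum_range_add]
    have hb : ∑ _m ∈ Finset.range s, (1 / 2 : ℝ) ^ (L + (J + 1)) ≤
        ∑ m ∈ Finset.range s, (1 / 2 : ℝ) ^ n (J * s + m) := by
      refine Finset.sum_le_sum fun m hm => ?_
      refine pow_le_pow_of_le_one (by norm_num) (by norm_num) (hn J _ ?_)
      have := Finset.mem_range.1 hm
      rw [add_mul, one_mul]
      omega
    rw [Finset.sum_const, Finset.card_range, nsmul_eq_mul] at hb
    calc _ = (1 / 2 : ℝ) ^ L * (s * (1 - (1 / 2) ^ J)) + s * (1 / 2 : ℝ) ^ (L + (J + 1)) := by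
          ring
      _ ≤ _ := add_le_add ih hb

/-- The converse half of the optimality of Golomb codes. If all lengths were below
`1 + L + (i - d) a`, then symbols `0, …, d` would have length at most `L` and the symbols with
`(i - d) a ≤ j` length at most `L + j`, and there are too many of these for Kraft's inequality. -/
theorem IsPrefixCode.exists_length_ge {c : ℕ → List Bool} (hc : IsPrefixCode c) {a : ℝ}
    (ha : 0 < a) {k L d : ℕ} (hk : 1 ≤ k) (hka : ((k : ℝ) - 1) * a < 1) (hd : d + k = 2 ^ L) :
    ∃ i : ℕ, 1 + (L : ℝ) + ((i : ℝ) - d) * a ≤ (c i).length := by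
  by_contra! hlt
  obtain ⟨s, rfl⟩ : ∃ s, k = s + 1 := ⟨k - 1, by omega⟩
  push_cast at hka
  have hsa : (s : ℝ) * a < 1 := by linarith
  have hlen : ∀ i j : ℕ, ((i : ℝ) - d) * a ≤ j → (c i).length ≤ L + j := by
    intro i j hij
    have h : ((c i).length : ℝ) < ((1 + L + j : ℕ) : ℝ) := by
      push_cast
      linarith [hlt i]
    have := Nat.cast_lt.1 h
    omega
  -- As `s a < 1`, at some level `J` there is room for a full block of `s + 1` extra symbols.
  obtain ⟨J, hJ⟩ := exists_nat_ge (((s : ℝ) + 1) * a / (1 - s * a))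
  have hJ' : ((J : ℝ) * s + (s + 1)) * a ≤ J := by
    rw [div_le_iff₀ (by linarith)] at hJ
    linarith
  have hsum := hc.sum_le_one (Finset.range (d + 1 + J * s + (s + 1)))
  rw [Finset.sum_range_add, Finset.sum_range_add] at hsum
  have h₁ : ∑ _i ∈ Finset.range (d + 1), (1 / 2 : ℝ) ^ L ≤
      ∑ i ∈ Finset.range (d + 1), (1 / 2 : ℝ) ^ (c i).length := by
    refine Finset.sum_le_sum fun i hi => pow_le_pow_of_le_one (by norm_num) (by norm_num) ?_
    have hid : (i : ℝ) ≤ d := by exact_mod_cast Nat.lt_succ_iff.1 (Finset.mem_range.1 hi)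
    refine hlen i 0 ?_
    push_cast
    exact mul_nonpos_of_nonpos_of_nonneg (by linarith) ha.le
  have h₂ := sum_blocks_ge (n := fun m => (c (d + 1 + m)).length) (L := L) (s := s)
    (fun j m hm => hlen _ _ (by
      have hm' : (m : ℝ) + 1 ≤ (j + 1) * s := by exact_mod_cast hm
      push_cast
      calc ((d : ℝ) + 1 + m - d) * a = (m + 1) * a := by ring
        _ ≤ ((j + 1) * s) * a := by gcongr
        _ = (j + 1) * (s * a) := by ring
        _ ≤ (j + 1) * 1 := by gcongr
        _ = j + 1 := by ring)) J
  have h₃ : ∑ _i ∈ Finset.range (s + 1), (1 / 2 : ℝ) ^ (L + J) ≤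
      ∑ i ∈ Finset.range (s + 1), (1 / 2 : ℝ) ^ (c (d + 1 + J * s + i)).length := by
    refine Finset.sum_le_sum fun i hi => pow_le_pow_of_le_one (by norm_num) (by norm_num) ?_
    have hi' : (i : ℝ) + 1 ≤ s + 1 := by exact_mod_cast Finset.mem_range.1 hi
    refine hlen _ _ (le_trans ?_ hJ')
    push_cast
    gcongr
    linarith
  rw [Finset.sum_const, Finset.card_range, nsmul_eq_mul] at h₁ h₃
  have hd' : (d : ℝ) + (s + 1) = 2 ^ L := by exact_mod_cast hd
  have hL : ((d : ℝ) + (s + 1)) * (1 / 2) ^ L = 1 := by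
    rw [hd', ← mul_pow]
    norm_num
  have hpos : (0 : ℝ) < (1 / 2) ^ L * (1 / 2) ^ J := by positivity
  have hid : ((d + 1 : ℕ) : ℝ) * (1 / 2) ^ L + (1 / 2 : ℝ) ^ L * (s * (1 - (1 / 2) ^ J)) +
      ((s + 1 : ℕ) : ℝ) * (1 / 2) ^ (L + J) = 1 + (1 / 2) ^ L * (1 / 2) ^ J := by
    push_cast
    rw [pow_add]
    linear_combination hL
  linarith

/-! ### Golomb codes -/

/-- The `l` lowest binary digits of `r`, most significant first. -/
def binaryDigits : ℕ → ℕ → List Bool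
  | 0, _ => []
  | l + 1, r => binaryDigits l (r / 2) ++ [decide (r % 2 = 1)]

lemma length_binaryDigits (l r : ℕ) : (binaryDigits l r).length = l := by
  induction l generalizing r with
  | zero => rfl
  | succ l ih => simp [binaryDigits, ih]

lemma binaryDigits_inj {l r s : ℕ} (hr : r < 2 ^ l) (hs : s < 2 ^ l)
    (h : binaryDigits l r = binaryDigits l s) : r = s := by
  induction l generalizing r s with
  | zero => simp at hr hs; omega
  | succ l ih =>
    rw [pow_succ] at hr hs
    obtain ⟨h₁, h₂⟩ := List.append_inj' h rfl
    have h₃ := ih (by omega) (by omega) h₁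
    have h₄ : r % 2 = 1 ↔ s % 2 = 1 := by simpa using h₂
    omega

/-- The complete binary code on `{0, …, k - 1}`, where `2 ^ (L - 1) < k ≤ 2 ^ L`: the first
`2 ^ L - k` symbols get `L - 1` digits, the others get `L` digits. -/
def truncatedBinary (k L r : ℕ) : List Bool :=
  if r < 2 ^ L - k then binaryDigits (L - 1) r else binaryDigits L (r + (2 ^ L - k))

/-- The Golomb code with parameter `k`: the quotient by `k` in unary, then the remainder in the
complete binary code on `k` symbols. -/
def golombCode (k L i : ℕ) : List Bool :=
  List.replicate (i / k) true ++ false :: truncatedBinary k L (i % k)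

lemma truncatedBinary_prefix {k L r s : ℕ} (hk : k ≤ 2 ^ L) (hL : 2 ^ L < 2 * k)
    (hr : r < k) (hs : s < k) (h : truncatedBinary k L r <+: truncatedBinary k L s) : r = s := by
  unfold truncatedBinary at h
  obtain ⟨d, hd⟩ : ∃ d, d = 2 ^ L - k := ⟨_, rfl⟩
  rw [← hd] at h
  cases L with
  | zero =>
    rw [pow_zero] at *
    omega
  | succ L =>
    rw [pow_succ] at *
    rw [Nat.add_sub_cancel] at h
    split_ifs at h with h₁ h₂ h₂
    · exact binaryDigits_inj (by omega) (by omega) (h.eq_of_length (by simp [length_binaryDigits]))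
    · -- The first `L` digits of `s + d` are those of `(s + d) / 2`, which is at least `d`.
      have h' : binaryDigits L r = binaryDigits L ((s + d) / 2) :=
        (List.prefix_of_prefix_length_le h (List.prefix_append _ _)
          (by simp [length_binaryDigits])).eq_of_length (by simp [length_binaryDigits])
      have := binaryDigits_inj (by omega) (by omega) h'
      omega
    · have := h.length_le
      simp [length_binaryDigits] at this
    · have := binaryDigits_inj (l := L + 1) (by rw [pow_succ]; omega) (by rw [pow_succ]; omega)
        (h.eq_of_length (by simp [length_binaryDigits]))
      omega

lemma unary_append_prefix {x y : List Bool} {q q' : ℕ}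
    (h : List.replicate q true ++ false :: x <+: List.replicate q' true ++ false :: y) :
    q = q' ∧ x <+: y := by
  induction q generalizing q' with
  | zero =>
    cases q' with
    | zero => simpa using h
    | succ q' => simp [List.replicate_succ] at h
  | succ q ih =>
    cases q' with
    | zero => simp [List.replicate_succ] at h
    | succ q' =>
      simp only [List.replicate_succ, List.cons_append, List.cons_prefix_cons, true_and] at h
      simpa using ih h

lemma isPrefixCode_golombCode {k L : ℕ} (hk : k ≤ 2 ^ L) (hL : 2 ^ L < 2 * k) :
    IsPrefixCode (golombCode k L) := by
  intro i j hij h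
  obtain ⟨hq, hr⟩ := unary_append_prefix h
  have hk0 : 0 < k := by omega
  have hr' := truncatedBinary_prefix hk hL (Nat.mod_lt _ hk0) (Nat.mod_lt _ hk0) hr
  apply hij
  rw [← Nat.div_add_mod i k, ← Nat.div_add_mod j k, hq, hr']

/-- Golomb codes attain the bound of `IsPrefixCode.exists_length_ge`: adding `k` to a symbol
costs one digit and `k a ≥ 1`, so it suffices to look at the first `k` symbols. -/
lemma length_golombCode_le {a : ℝ} (ha : 0 < a) {k L d : ℕ} (hka : ((k : ℝ) - 1) * a < 1)
    (hka' : 1 ≤ k * a) (hd : d + k = 2 ^ L) (hL : 2 ^ L < 2 * k) (i : ℕ) :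
    ((golombCode k L i).length : ℝ) ≤ 1 + (L : ℝ) + ((i : ℝ) - d) * a := by
  have hi : (k : ℝ) * (i / k : ℕ) + (i % k : ℕ) = i := by exact_mod_cast Nat.div_add_mod i k
  have hq : ((i / k : ℕ) : ℝ) ≤ (i / k : ℕ) * (k * a) :=
    le_mul_of_one_le_right (Nat.cast_nonneg _) hka'
  have hdk : (d : ℝ) + 1 ≤ k := by
    have : d + 1 ≤ k := by omega
    exact_mod_cast this
  have hd' : 2 ^ L - k = d := by omega
  rw [golombCode, truncatedBinary, hd', ← hi]
  split_ifs with h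
  · have hL0 : 1 ≤ L := by
      by_contra h0
      obtain rfl : L = 0 := by omega
      rw [pow_zero] at *
      omega
    have hda : (d : ℝ) * a ≤ (k - 1) * a := by gcongr; linarith
    have hr : 0 ≤ ((i % k : ℕ) : ℝ) * a := by positivity
    simp only [List.length_append, List.length_replicate, List.length_cons, length_binaryDigits]
    push_cast [Nat.cast_sub hL0]
    linarith
  · have hr : (d : ℝ) ≤ (i % k : ℕ) := by exact_mod_cast not_lt.1 h
    have hr' : 0 ≤ (((i % k : ℕ) : ℝ) - d) * a := mul_nonneg (by linarith) ha.le
    simp only [List.length_append, List.length_replicate, List.length_cons, length_binaryDigits]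
    push_cast
    linarith

/-! ### The optimal redundancy of a geometric source -/

/-- The closed form `1 + ⌈log₂ k⌉ + log₂ (1 - θ) + (2 ^ ⌈log₂ k⌉ - k) log₂ θ`, with
`k = ⌈-1 / log₂ θ⌉`, of the optimal maximal pointwise redundancy. -/
noncomputable def geometricRedundancy (θ : ℝ) : ℝ :=
  1 + (⌈Real.logb 2 (⌈-(1 / Real.logb 2 θ)⌉ : ℝ)⌉ : ℝ) + Real.logb 2 (1 - θ)
    + ((2 : ℝ) ^ (⌈Real.logb 2 (⌈-(1 / Real.logb 2 θ)⌉ : ℝ)⌉ : ℤ)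
        - (⌈-(1 / Real.logb 2 θ)⌉ : ℝ)) * Real.logb 2 θ

lemma neg_logb_pos {θ : ℝ} (h : 1 / 2 ≤ θ) (h1 : θ < 1) : 0 < -Real.logb 2 θ :=
  neg_pos.2 (Real.logb_neg (by norm_num) (by linarith) h1)

lemma neg_logb_le_one {θ : ℝ} (h : 1 / 2 ≤ θ) : -Real.logb 2 θ ≤ 1 := by
  have := (Real.le_logb_iff_rpow_le (b := 2) (x := -1) (y := θ) (by norm_num) (by linarith)).2
    (by rw [Real.rpow_neg_one]; linarith)
  linarith

/-- The logarithms of `x` and of `⌈x⌉` lie between the same integers, powers of two with a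
natural exponent being integers. -/
lemma ceil_logb_ceil {x : ℝ} (hx : 1 ≤ x) : ⌈Real.logb 2 (⌈x⌉ : ℝ)⌉ = ⌈Real.logb 2 x⌉ := by
  have hx' : (1 : ℝ) ≤ ⌈x⌉ := hx.trans (Int.le_ceil x)
  refine eq_of_forall_ge_iff fun m => ?_
  rw [Int.ceil_le, Int.ceil_le, Real.logb_le_iff_le_rpow (by norm_num) (by linarith),
    Real.logb_le_iff_le_rpow (by norm_num) (by linarith), Real.rpow_intCast]
  rcases lt_or_ge m 0 with hm | hm
  · have : (2 : ℝ) ^ m < 1 := zpow_lt_one_of_neg₀ (by norm_num) hm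
    constructor <;> intro h <;> linarith
  · lift m to ℕ using hm
    rw [zpow_natCast]
    have h : ((2 : ℝ) ^ m) = ((2 ^ m : ℤ) : ℝ) := by push_cast; rfl
    rw [h, Int.cast_le, Int.ceil_le]

/-- The parameters `k` and `L` of the Golomb code for `a = -log₂ θ`, as natural numbers. -/
lemma exists_golomb_parameters {θ : ℝ} (h : 1 / 2 ≤ θ) (h1 : θ < 1) :
    ∃ k L d : ℕ, 1 ≤ k ∧ ((k : ℝ) - 1) * (-Real.logb 2 θ) < 1 ∧ 1 ≤ k * (-Real.logb 2 θ) ∧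
      d + k = 2 ^ L ∧ 2 ^ L < 2 * k ∧ geometricRedundancy θ =
        1 + L + Real.logb 2 (1 - θ) + d * Real.logb 2 θ := by
  have ha := neg_logb_pos h h1
  have ha1 := neg_logb_le_one h
  have hx : -(1 / Real.logb 2 θ) = 1 / (-Real.logb 2 θ) := by rw [one_div_neg_eq_neg_one_div]
  unfold geometricRedundancy
  rw [hx]
  set a := -Real.logb 2 θ with hadef
  have hθ : Real.logb 2 θ = -a := by rw [hadef, neg_neg]
  have hx1 : 1 ≤ 1 / a := by rwa [le_div_iff₀ ha, one_mul]
  obtain ⟨k, hk⟩ : ∃ k : ℕ, ⌈1 / a⌉ = k := Int.eq_ofNat_of_zero_le (Int.ceil_nonneg (by linarith))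
  have hxk : 1 / a ≤ k := by exact_mod_cast hk ▸ Int.le_ceil (1 / a)
  have hkx : (k : ℝ) < 1 / a + 1 := by exact_mod_cast hk ▸ Int.ceil_lt_add_one (1 / a)
  have hk1 : (1 : ℝ) ≤ k := hx1.trans hxk
  have hkpos : (0 : ℝ) < k := by linarith
  obtain ⟨L, hL⟩ : ∃ L : ℕ, ⌈Real.logb 2 (k : ℝ)⌉ = L :=
    Int.eq_ofNat_of_zero_le (Int.ceil_nonneg (Real.logb_nonneg (by norm_num) hk1))
  have hkL : (k : ℝ) ≤ 2 ^ L := by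
    have : Real.logb 2 (k : ℝ) ≤ L := by exact_mod_cast hL ▸ Int.le_ceil (Real.logb 2 (k : ℝ))
    rwa [Real.logb_le_iff_le_rpow (by norm_num) hkpos, Real.rpow_natCast] at this
  have hLk : (2 : ℝ) ^ L < 2 * k := by
    have : (L : ℝ) < Real.logb 2 (k : ℝ) + 1 := by
      exact_mod_cast hL ▸ Int.ceil_lt_add_one (Real.logb 2 (k : ℝ))
    have h2 : (L : ℝ) - 1 < Real.logb 2 (k : ℝ) := by linarith
    rw [Real.lt_logb_iff_rpow_lt (by norm_num) hkpos, Real.rpow_sub_one (by norm_num),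
      Real.rpow_natCast] at h2
    linarith
  have hkL' : k ≤ 2 ^ L := by exact_mod_cast hkL
  refine ⟨k, L, 2 ^ L - k, by exact_mod_cast hk1, ?_, ?_, by omega, by exact_mod_cast hLk, ?_⟩
  · rw [← lt_div_iff₀ ha]
    linarith
  · rwa [div_le_iff₀ ha] at hxk
  · rw [hk, Int.cast_natCast, hL, Int.cast_natCast, zpow_natCast, Nat.cast_sub hkL']
    push_cast
    rfl

lemma pointwiseRedundancy_geometricProb (c : ℕ → List Bool) {θ : ℝ} (h : 1 / 2 ≤ θ) (h1 : θ < 1)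
    (i : ℕ) : pointwiseRedundancy c (geometricProb θ) i =
      (c i).length + Real.logb 2 (1 - θ) + i * Real.logb 2 θ := by
  have h0 : θ ≠ 0 := by linarith
  rw [pointwiseRedundancy, geometricProb, Real.logb_mul (by linarith) (pow_ne_zero i h0),
    Real.logb_pow, add_assoc]

lemma IsPrefixCode.exists_pointwiseRedundancy_ge {c : ℕ → List Bool} (hc : IsPrefixCode c) {θ : ℝ}
    (h : 1 / 2 ≤ θ) (h1 : θ < 1) :
    ∃ i, geometricRedundancy θ ≤ pointwiseRedundancy c (geometricProb θ) i := by
  obtain ⟨k, L, d, hk, hka, -, hd, -, hρ⟩ := exists_golomb_parameters h h1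
  obtain ⟨i, hi⟩ := hc.exists_length_ge (neg_logb_pos h h1) hk hka hd
  refine ⟨i, ?_⟩
  rw [hρ, pointwiseRedundancy_geometricProb c h h1]
  linarith

lemma exists_isPrefixCode_pointwiseRedundancy_le {θ : ℝ} (h : 1 / 2 ≤ θ) (h1 : θ < 1) :
    ∃ c, IsPrefixCode c ∧
      ∀ i, pointwiseRedundancy c (geometricProb θ) i ≤ geometricRedundancy θ := by
  obtain ⟨k, L, d, hk, hka, hka', hd, hL, hρ⟩ := exists_golomb_parameters h h1
  refine ⟨golombCode k L, isPrefixCode_golombCode (by omega) hL, fun i => ?_⟩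
  rw [hρ, pointwiseRedundancy_geometricProb _ h h1]
  have := length_golombCode_le (neg_logb_pos h h1) hka hka' hd hL i
  linarith

lemma IsPrefixCode.geometricRedundancy_le {c : ℕ → List Bool} (hc : IsPrefixCode c) {θ : ℝ}
    (h : 1 / 2 ≤ θ) (h1 : θ < 1) :
    (geometricRedundancy θ : EReal) ≤ maximalRedundancy c (geometricProb θ) := by
  obtain ⟨i, hi⟩ := hc.exists_pointwiseRedundancy_ge h h1
  exact le_iSup_of_le i (EReal.coe_le_coe_iff.2 hi)

lemma exists_isPrefixCode_maximalRedundancy_le {θ : ℝ} (h : 1 / 2 ≤ θ) (h1 : θ < 1) :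
    ∃ c, IsPrefixCode c ∧ maximalRedundancy c (geometricProb θ) ≤ geometricRedundancy θ := by
  obtain ⟨c, hc, hle⟩ := exists_isPrefixCode_pointwiseRedundancy_le h h1
  exact ⟨c, hc, iSup_le fun i => EReal.coe_le_coe_iff.2 (hle i)⟩

theorem exists_minimizesMaximalRedundancy {θ : ℝ} (h : 1 / 2 ≤ θ) (h1 : θ < 1) :
    ∃ c, MinimizesMaximalRedundancy c (geometricProb θ) := by
  obtain ⟨c, hc, hle⟩ := exists_isPrefixCode_maximalRedundancy_le h h1
  exact ⟨c, hc, fun c' hc' => hle.trans (hc'.geometricRedundancy_le h h1)⟩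

theorem MinimizesMaximalRedundancy.isGreatest {c : ℕ → List Bool} {θ : ℝ}
    (hc : MinimizesMaximalRedundancy c (geometricProb θ)) (h : 1 / 2 ≤ θ) (h1 : θ < 1) :
    IsGreatest (Set.range (pointwiseRedundancy c (geometricProb θ))) (geometricRedundancy θ) := by
  obtain ⟨c', hc', hle⟩ := exists_isPrefixCode_maximalRedundancy_le h h1
  have hsup := (hc.2 c' hc').trans hle
  rw [maximalRedundancy, iSup_le_iff] at hsup
  have hub : ∀ i, pointwiseRedundancy c (geometricProb θ) i ≤ geometricRedundancy θ :=
    fun i => EReal.coe_le_coe_iff.1 (hsup i)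
  obtain ⟨i, hi⟩ := hc.1.exists_pointwiseRedundancy_ge h h1
  refine ⟨⟨i, le_antisymm (hub i) hi⟩, ?_⟩
  rintro _ ⟨j, rfl⟩
  exact hub j

theorem minimalMaximalRedundancy_geometricProb {θ : ℝ} (h : 1 / 2 ≤ θ) (h1 : θ < 1) :
    minimalMaximalRedundancy (geometricProb θ) = geometricRedundancy θ := by
  obtain ⟨c, hc, hle⟩ := exists_isPrefixCode_maximalRedundancy_le h h1
  rw [minimalMaximalRedundancy]
  refine le_antisymm (le_trans ?_ hle) (le_iInf fun c => c.2.geometricRedundancy_le h h1)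
  exact iInf_le (fun c : {c : ℕ → List Bool // IsPrefixCode c} =>
    maximalRedundancy c.1 (geometricProb θ)) ⟨c, hc⟩

/-- The closed form in terms of `l = log₂ (-1 / log₂ θ)`: one has `⌈log₂ k⌉ = ⌈l⌉`, which is
`⌊l⌋ + 1` unless `l` is an integer; in the latter case both sides agree as well. -/
theorem geometricRedundancy_eq {θ : ℝ} (h : 1 / 2 ≤ θ) (h1 : θ < 1) :
    geometricRedundancy θ = 2 + Real.logb 2 (-((1 - θ) / Real.logb 2 θ))
      - (⌈-(1 / Real.logb 2 θ)⌉ : ℝ) * Real.logb 2 θ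
      - (2 : ℝ) ^ (1 - Int.fract (Real.logb 2 (-(1 / Real.logb 2 θ))))
      - Int.fract (Real.logb 2 (-(1 / Real.logb 2 θ))) := by
  have ha := neg_logb_pos h h1
  have ha1 := neg_logb_le_one h
  have hx1 : 1 ≤ -(1 / Real.logb 2 θ) := by
    rwa [← one_div_neg_eq_neg_one_div, le_div_iff₀ ha, one_mul]
  have hmul : -((1 - θ) / Real.logb 2 θ) = (1 - θ) * -(1 / Real.logb 2 θ) := by ring
  have hθ : Real.logb 2 θ ≠ 0 := by linarith
  unfold geometricRedundancy
  rw [ceil_logb_ceil hx1, hmul, Real.logb_mul (by linarith) (by linarith)]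
  have hpow : (2 : ℝ) ^ Real.logb 2 (-(1 / Real.logb 2 θ)) * Real.logb 2 θ = -1 := by
    rw [Real.rpow_logb (by norm_num) (by norm_num) (by linarith)]
    field_simp
  set l := Real.logb 2 (-(1 / Real.logb 2 θ))
  rcases eq_or_ne (Int.fract l) 0 with hf | hf
  · have hl : (⌈l⌉ : ℝ) = l := by
      have := Int.self_sub_floor l
      rw [hf, sub_eq_zero] at this
      rw [this, Int.ceil_intCast]
    have h2 : (2 : ℝ) ^ ((1 : ℝ) - 0) = 2 := by norm_num
    rw [hf, ← Real.rpow_intCast, hl, h2]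
    linear_combination hpow
  · have hl : (⌈l⌉ : ℝ) = l + (1 - Int.fract l) := by
      rw [Int.ceil_eq_add_one_sub_fract hf]
      ring
    rw [← Real.rpow_intCast, hl, Real.rpow_add (by norm_num)]
    linear_combination (2 : ℝ) ^ (1 - Int.fract l) * hpow

/-! ### Asymptotics as `θ ↑ 1` -/

/-- The oscillating term of the expansion, as a function of `t = ⟨log₂ (-1 / log₂ θ)⟩`. -/
noncomputable def redundancyOscillation (t : ℝ) : ℝ := (2 : ℝ) ^ (1 - t) + t

lemma redundancyOscillation_zero : redundancyOscillation 0 = 2 := by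
  norm_num [redundancyOscillation]

lemma logb_exp_one : Real.logb 2 (Real.exp 1) = 1 / Real.log 2 := by
  rw [Real.logb, Real.log_exp]

lemma one_lt_logb_exp_one : 1 < Real.logb 2 (Real.exp 1) := by
  have := Real.log_two_lt_d9
  rw [logb_exp_one, lt_div_iff₀ (Real.log_pos (by norm_num))]
  linarith

lemma logb_exp_one_lt_two : Real.logb 2 (Real.exp 1) < 2 := by
  have := Real.log_two_gt_d9
  rw [logb_exp_one, div_lt_iff₀ (Real.log_pos (by norm_num))]
  linarith

/-- By convexity, `2 ^ u ≤ 1 + u` on `[0, 1]`. -/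
lemma redundancyOscillation_le_two {t : ℝ} (h0 : 0 ≤ t) (h1 : t ≤ 1) :
    redundancyOscillation t ≤ 2 := by
  have := rpow_one_add_le_one_add_mul_self (s := 1) (p := 1 - t) (by norm_num)
    (by linarith) (by linarith)
  norm_num at this
  rw [redundancyOscillation]
  linarith

/-- The tangent to `2 ^ u` of slope one, at `u = log₂ log₂ e`, lies below the graph. -/
lemma le_redundancyOscillation (t : ℝ) :
    1 + Real.logb 2 (Real.exp 1) - Real.logb 2 (Real.logb 2 (Real.exp 1)) ≤
      redundancyOscillation t := by
  have hlog : 0 < Real.log 2 := Real.log_pos (by norm_num)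
  have he : 0 < Real.logb 2 (Real.exp 1) := by linarith [one_lt_logb_exp_one]
  set u := Real.logb 2 (Real.logb 2 (Real.exp 1)) with hu
  have hpow : (2 : ℝ) ^ u = Real.logb 2 (Real.exp 1) :=
    Real.rpow_logb (by norm_num) (by norm_num) he
  have hsplit : (2 : ℝ) ^ (1 - t) = (2 : ℝ) ^ u * Real.exp (Real.log 2 * (1 - t - u)) := by
    rw [← Real.rpow_def_of_pos (by norm_num), ← Real.rpow_add (by norm_num)]
    congr 1
    ring
  have hexp := Real.add_one_le_exp (Real.log 2 * (1 - t - u))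
  have h := mul_le_mul_of_nonneg_left hexp he.le
  have hone : Real.logb 2 (Real.exp 1) * Real.log 2 = 1 := by
    rw [logb_exp_one, one_div_mul_cancel hlog.ne']
  rw [redundancyOscillation, hsplit, hpow]
  linear_combination h - (1 - t - u) * hone

lemma redundancyOscillation_argmin :
    redundancyOscillation (1 - Real.logb 2 (Real.logb 2 (Real.exp 1))) =
    1 + Real.logb 2 (Real.exp 1) - Real.logb 2 (Real.logb 2 (Real.exp 1)) := by
  rw [redundancyOscillation, sub_sub_cancel,
    Real.rpow_logb (by norm_num) (by norm_num) (by linarith [one_lt_logb_exp_one])]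
  ring

/-- The expansion with an explicit error: `k (-log₂ θ)` exceeds `1` by less than `-log₂ θ`, and
`(1 - θ) / (-ln θ)` lies between `θ` and `1`. -/
theorem abs_geometricRedundancy_sub_le {θ : ℝ} (h : 1 / 2 ≤ θ) (h1 : θ < 1) :
    |geometricRedundancy θ - (3 - Real.logb 2 (Real.logb 2 (Real.exp 1))
      - redundancyOscillation (Int.fract (Real.logb 2 (-(1 / Real.logb 2 θ)))))| ≤ -Real.logb 2 θ := by
  have h0 : 0 < θ := by linarith
  have ha := neg_logb_pos h h1
  have hlog : 0 < Real.log 2 := Real.log_pos (by norm_num)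
  have hlogθ : Real.log θ < 0 := Real.log_neg h0 h1
  have hle := Real.log_le_sub_one_of_pos h0
  have hge := Real.one_sub_inv_le_log_of_pos h0
  have hfrac : -((1 - θ) / Real.logb 2 θ) =
      (1 - θ) / (-Real.log θ) / Real.logb 2 (Real.exp 1) := by
    rw [logb_exp_one, Real.logb]
    field_simp
  have hq : 0 < (1 - θ) / (-Real.log θ) := div_pos (by linarith) (by linarith)
  have hq1 : (1 - θ) / (-Real.log θ) ≤ 1 := by
    rw [div_le_one (by linarith)]
    linarith
  have hqθ : θ ≤ (1 - θ) / (-Real.log θ) := by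
    rw [le_div_iff₀ (by linarith)]
    have := mul_le_mul_of_nonneg_left hge h0.le
    rw [mul_sub, mul_inv_cancel₀ h0.ne'] at this
    linarith
  have hl1 : Real.logb 2 ((1 - θ) / (-Real.log θ)) ≤ 0 :=
    Real.logb_nonpos (by norm_num) hq.le hq1
  have hlθ : Real.logb 2 θ ≤ Real.logb 2 ((1 - θ) / (-Real.log θ)) :=
    Real.logb_le_logb_of_le (by norm_num) h0 hqθ
  have hk : 1 ≤ (⌈-(1 / Real.logb 2 θ)⌉ : ℝ) * (-Real.logb 2 θ) := by
    rw [← div_le_iff₀ ha, one_div_neg_eq_neg_one_div]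
    exact Int.le_ceil _
  have hk' : (⌈-(1 / Real.logb 2 θ)⌉ : ℝ) * (-Real.logb 2 θ) ≤ 1 + -Real.logb 2 θ := by
    rw [← le_div_iff₀ ha, add_div, div_self ha.ne', one_div_neg_eq_neg_one_div]
    exact (Int.ceil_lt_add_one _).le
  rw [geometricRedundancy_eq h h1, hfrac, Real.logb_div hq.ne' (by linarith [one_lt_logb_exp_one]),
    redundancyOscillation, abs_le]
  constructor <;> linarith

lemma neg_logb_le_mul_one_sub {θ : ℝ} (h : 1 / 2 ≤ θ) (h1 : θ < 1) :
    -Real.logb 2 θ ≤ 2 / Real.log 2 * (1 - θ) := by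
  have h0 : 0 < θ := by linarith
  have hge := Real.one_sub_inv_le_log_of_pos h0
  have hinv : θ⁻¹ ≤ 2 * (1 - θ) + 1 := by
    rw [inv_le_iff_one_le_mul₀ h0]
    nlinarith
  rw [Real.logb, ← neg_div, div_mul_eq_mul_div]
  exact div_le_div_of_nonneg_right (by linarith) (Real.log_pos (by norm_num)).le

lemma eventually_mem_Ico_half_one : ∀ᶠ θ : ℝ in 𝓝[<] 1, 1 / 2 ≤ θ ∧ θ < 1 :=
  Ico_mem_nhdsLT (by norm_num)

lemma tendsto_logb_nhdsLT_one : Tendsto (fun θ : ℝ => Real.logb 2 θ) (𝓝[<] 1) (𝓝 0) := by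
  have h : ContinuousAt (fun θ : ℝ => Real.logb 2 θ) 1 :=
    (Real.continuousAt_log one_ne_zero).div_const _
  have h' := h.tendsto
  rw [Real.logb_one] at h'
  exact h'.mono_left nhdsWithin_le_nhds

/-- The sources `θ = 2 ^ (-2 ^ (-(m + t)))`, which approach `1` while `⟨log₂ (-1 / log₂ θ)⟩` stays
equal to `t`. -/
noncomputable def dyadicSource (t : ℝ) (m : ℕ) : ℝ := (2 : ℝ) ^ (-(2 : ℝ) ^ (-((m : ℝ) + t)))

lemma logb_dyadicSource (t : ℝ) (m : ℕ) :
    Real.logb 2 (dyadicSource t m) = -(2 : ℝ) ^ (-((m : ℝ) + t)) :=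
  Real.logb_rpow (by norm_num) (by norm_num)

lemma fract_dyadicSource {t : ℝ} (h0 : 0 ≤ t) (h1 : t < 1) (m : ℕ) :
    Int.fract (Real.logb 2 (-(1 / Real.logb 2 (dyadicSource t m)))) = t := by
  rw [logb_dyadicSource, one_div_neg_eq_neg_one_div, neg_neg, one_div,
    ← Real.rpow_neg (by norm_num), neg_neg, Real.logb_rpow (by norm_num) (by norm_num),
    Int.fract_natCast_add, Int.fract_eq_self.2 ⟨h0, h1⟩]

lemma tendsto_dyadicSource (t : ℝ) : Tendsto (dyadicSource t) atTop (𝓝[<] 1) := by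
  refine tendsto_nhdsWithin_iff.2 ⟨?_, Eventually.of_forall fun m => ?_⟩
  · have h1 : Tendsto (fun m : ℕ => (2 : ℝ) ^ (-((m : ℝ) + t))) atTop (𝓝 0) := by
      refine (tendsto_rpow_atBot_of_base_gt_one 2 (by norm_num)).comp ?_
      exact tendsto_neg_atTop_atBot.comp
        (tendsto_atTop_add_const_right _ t tendsto_natCast_atTop_atTop)
    have h2 : ContinuousAt (fun x : ℝ => (2 : ℝ) ^ x) (-0) :=
      Real.continuousAt_const_rpow (by norm_num)
    have h3 := h2.tendsto.comp h1.neg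
    rwa [neg_zero, Real.rpow_zero] at h3
  · exact Real.rpow_lt_one_of_one_lt_of_neg (by norm_num)
      (neg_neg_of_pos (Real.rpow_pos_of_pos (by norm_num) _))

/-- Along `dyadicSource t` the optimal redundancy converges to the value of the expansion at `t`. -/
lemma tendsto_minimalMaximalRedundancy_dyadicSource {t : ℝ} (h0 : 0 ≤ t) (h1 : t < 1) :
    Tendsto (fun m => minimalMaximalRedundancy (geometricProb (dyadicSource t m))) atTop
      (𝓝 ((3 - Real.logb 2 (Real.logb 2 (Real.exp 1)) - redundancyOscillation t : ℝ) : EReal)) := by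
  have hreal : Tendsto (fun m => geometricRedundancy (dyadicSource t m)) atTop
      (𝓝 (3 - Real.logb 2 (Real.logb 2 (Real.exp 1)) - redundancyOscillation t)) := by
    rw [tendsto_iff_dist_tendsto_zero]
    have hlog := (tendsto_logb_nhdsLT_one.comp (tendsto_dyadicSource t)).neg
    rw [neg_zero] at hlog
    refine squeeze_zero' (Eventually.of_forall fun m => dist_nonneg) ?_ hlog
    filter_upwards [(tendsto_dyadicSource t).eventually eventually_mem_Ico_half_one] with m hm
    have h := abs_geometricRedundancy_sub_le hm.1 hm.2
    rwa [fract_dyadicSource h0 h1] at h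
  refine (EReal.tendsto_coe.2 hreal).congr' ?_
  filter_upwards [(tendsto_dyadicSource t).eventually eventually_mem_Ico_half_one] with m hm
  exact (minimalMaximalRedundancy_geometricProb hm.1 hm.2).symm

/-- The limit inferior is governed by the maximum `2` of the oscillating term, taken at `t = 0`. -/
theorem liminf_minimalMaximalRedundancy :
    liminf (fun θ : ℝ => minimalMaximalRedundancy (geometricProb θ)) (𝓝[<] (1 : ℝ))
      = ((1 - Real.logb 2 (Real.logb 2 (Real.exp 1)) : ℝ) : EReal) := by
  refine le_antisymm ?_ ?_
  · have h := tendsto_minimalMaximalRedundancy_dyadicSource le_rfl zero_lt_one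
    rw [redundancyOscillation_zero] at h
    have hle := liminf_le_liminf_of_le (tendsto_dyadicSource 0)
      (u := fun θ : ℝ => minimalMaximalRedundancy (geometricProb θ))
    refine hle.trans (h.liminf_eq.le.trans (EReal.coe_le_coe_iff.2 ?_))
    linarith
  · have hlim : Tendsto (fun θ : ℝ => ((1 - Real.logb 2 (Real.logb 2 (Real.exp 1))
        + Real.logb 2 θ : ℝ) : EReal)) (𝓝[<] 1)
        (𝓝 ((1 - Real.logb 2 (Real.logb 2 (Real.exp 1)) : ℝ) : EReal)) := by
      have h := tendsto_logb_nhdsLT_one.const_add (1 - Real.logb 2 (Real.logb 2 (Real.exp 1)))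
      rw [add_zero] at h
      exact EReal.tendsto_coe.2 h
    rw [← hlim.liminf_eq]
    refine liminf_le_liminf ?_
    filter_upwards [eventually_mem_Ico_half_one] with θ hθ
    rw [minimalMaximalRedundancy_geometricProb hθ.1 hθ.2, EReal.coe_le_coe_iff]
    have h := (abs_le.1 (abs_geometricRedundancy_sub_le hθ.1 hθ.2)).1
    have ho := redundancyOscillation_le_two
      (Int.fract_nonneg (Real.logb 2 (-(1 / Real.logb 2 θ)))) (Int.fract_lt_one _).le
    linarith

/-- The limit superior is governed by the minimum of the oscillating term. -/
theorem limsup_minimalMaximalRedundancy :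
    limsup (fun θ : ℝ => minimalMaximalRedundancy (geometricProb θ)) (𝓝[<] (1 : ℝ))
      = ((2 - Real.logb 2 (Real.exp 1) : ℝ) : EReal) := by
  refine le_antisymm ?_ ?_
  · have hlim : Tendsto (fun θ : ℝ => ((2 - Real.logb 2 (Real.exp 1)
        - Real.logb 2 θ : ℝ) : EReal)) (𝓝[<] 1)
        (𝓝 ((2 - Real.logb 2 (Real.exp 1) : ℝ) : EReal)) := by
      have h := tendsto_logb_nhdsLT_one.const_sub (2 - Real.logb 2 (Real.exp 1))
      rw [sub_zero] at h
      exact EReal.tendsto_coe.2 h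
    rw [← hlim.limsup_eq]
    refine limsup_le_limsup ?_
    filter_upwards [eventually_mem_Ico_half_one] with θ hθ
    rw [minimalMaximalRedundancy_geometricProb hθ.1 hθ.2, EReal.coe_le_coe_iff]
    have h := (abs_le.1 (abs_geometricRedundancy_sub_le hθ.1 hθ.2)).2
    have ho := le_redundancyOscillation (Int.fract (Real.logb 2 (-(1 / Real.logb 2 θ))))
    linarith
  · have he := one_lt_logb_exp_one
    have hpos : 0 < Real.logb 2 (Real.logb 2 (Real.exp 1)) := Real.logb_pos (by norm_num) he
    have hle1 : Real.logb 2 (Real.logb 2 (Real.exp 1)) ≤ 1 := by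
      rw [Real.logb_le_iff_le_rpow (by norm_num) (by linarith), Real.rpow_one]
      exact logb_exp_one_lt_two.le
    have h := tendsto_minimalMaximalRedundancy_dyadicSource (sub_nonneg.2 hle1)
      (sub_lt_self 1 hpos)
    rw [redundancyOscillation_argmin] at h
    have hle := limsup_le_limsup_of_le
      (tendsto_dyadicSource (1 - Real.logb 2 (Real.logb 2 (Real.exp 1))))
      (u := fun θ : ℝ => minimalMaximalRedundancy (geometricProb θ))
    refine le_trans (le_trans (EReal.coe_le_coe_iff.2 ?_) h.limsup_eq.ge) hle
    linarith

theorem isBigO_minimalMaximalRedundancy :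
    (fun θ : ℝ => (minimalMaximalRedundancy (geometricProb θ)).toReal
        - (3 - Real.logb 2 (Real.logb 2 (Real.exp 1))
            - (2 : ℝ) ^ (1 - Int.fract (Real.logb 2 (-(1 / Real.logb 2 θ))))
            - Int.fract (Real.logb 2 (-(1 / Real.logb 2 θ)))))
      =O[𝓝[<] (1 : ℝ)] (fun θ : ℝ => 1 - θ) := by
  refine IsBigO.of_bound (2 / Real.log 2) ?_
  filter_upwards [eventually_mem_Ico_half_one] with θ hθ
  have h := (abs_geometricRedundancy_sub_le hθ.1 hθ.2).trans (neg_logb_le_mul_one_sub hθ.1 hθ.2)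
  rw [redundancyOscillation, ← sub_sub] at h
  rwa [minimalMaximalRedundancy_geometricProb hθ.1 hθ.2, EReal.toReal_coe, Real.norm_eq_abs,
    Real.norm_of_nonneg (by linarith [hθ.2])]

theorem mainTheorem6 :
    -- the closed form: a minimizing code exists, and for each minimizing code the supremum
    -- of the pointwise redundancy is a maximum, equal to both expressions
    (∀ θ : ℝ, 1 / 2 ≤ θ → θ < 1 →
      (∃ c : ℕ → List Bool, MinimizesMaximalRedundancy c (geometricProb θ)) ∧
      (∀ c : ℕ → List Bool, MinimizesMaximalRedundancy c (geometricProb θ) →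
        IsGreatest (Set.range (pointwiseRedundancy c (geometricProb θ)))
          (1 + (⌈Real.logb 2 (⌈-(1 / Real.logb 2 θ)⌉ : ℝ)⌉ : ℝ) + Real.logb 2 (1 - θ)
            + ((2 : ℝ) ^ (⌈Real.logb 2 (⌈-(1 / Real.logb 2 θ)⌉ : ℝ)⌉ : ℤ)
                - (⌈-(1 / Real.logb 2 θ)⌉ : ℝ)) * Real.logb 2 θ)) ∧
      minimalMaximalRedundancy (geometricProb θ) =
        ((1 + (⌈Real.logb 2 (⌈-(1 / Real.logb 2 θ)⌉ : ℝ)⌉ : ℝ) + Real.logb 2 (1 - θ)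
            + ((2 : ℝ) ^ (⌈Real.logb 2 (⌈-(1 / Real.logb 2 θ)⌉ : ℝ)⌉ : ℤ)
                - (⌈-(1 / Real.logb 2 θ)⌉ : ℝ)) * Real.logb 2 θ : ℝ) : EReal) ∧
      minimalMaximalRedundancy (geometricProb θ) =
        ((2 + Real.logb 2 (-((1 - θ) / Real.logb 2 θ))
            - (⌈-(1 / Real.logb 2 θ)⌉ : ℝ) * Real.logb 2 θ
            - (2 : ℝ) ^ (1 - Int.fract (Real.logb 2 (-(1 / Real.logb 2 θ))))
            - Int.fract (Real.logb 2 (-(1 / Real.logb 2 θ))) : ℝ) : EReal)) ∧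
    -- the asymptotic expansion as `θ ↑ 1`
    (fun θ : ℝ => (minimalMaximalRedundancy (geometricProb θ)).toReal
        - (3 - Real.logb 2 (Real.logb 2 (Real.exp 1))
            - (2 : ℝ) ^ (1 - Int.fract (Real.logb 2 (-(1 / Real.logb 2 θ))))
            - Int.fract (Real.logb 2 (-(1 / Real.logb 2 θ)))))
      =O[𝓝[<] (1 : ℝ)] (fun θ : ℝ => 1 - θ) ∧
    -- the limit inferior and the limit superior as `θ ↑ 1`
    liminf (fun θ : ℝ => minimalMaximalRedundancy (geometricProb θ)) (𝓝[<] (1 : ℝ))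
      = ((1 - Real.logb 2 (Real.logb 2 (Real.exp 1)) : ℝ) : EReal) ∧
    limsup (fun θ : ℝ => minimalMaximalRedundancy (geometricProb θ)) (𝓝[<] (1 : ℝ))
      = ((2 - Real.logb 2 (Real.exp 1) : ℝ) : EReal) := by
  refine ⟨fun θ h h1 => ⟨exists_minimizesMaximalRedundancy h h1, fun c hc => hc.isGreatest h h1,
    minimalMaximalRedundancy_geometricProb h h1, ?_⟩, isBigO_minimalMaximalRedundancy,
    liminf_minimalMaximalRedundancy, limsup_minimalMaximalRedundancy⟩
  rw [minimalMaximalRedundancy_geometricProb h h1, geometricRedundancy_eq h h1]
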